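/- Let $\oplus$ be a continuous t-conorm on $[0,1]$, i.e. a jointly continuous, associative, commutative operation, monotone in each variable, with neutral element $0$. Let $X$ be a set and let $w:X\times X\times(0,\infty)\to[0,1)$ be a quasi-modular gauge: for all $x,y,z\in X$ and $t,s>0$, (W1) $w(x,y,t)=0$ if and only if $x=y$; (W3) $w(x,z,t+s)\le w(x,y,t)\oplus w(y,z,s)$; (W4) $t\mapsto w(x,y,t)$ is continuous and nonincreasing. (Symmetry of $w$ is not required.) Put $w^{\mathrm{sym}}(x,y,t)=w(x,y,t)\oplus w(y,x,t)$, and let $\mathcal U(w^{\mathrm{sym}})$ be the uniformity on $X$ generated by the sets $\{(x,y): w^{\mathrm{sym}}(x,y,t)<r\}$, $r\in(0,1)$, $t>0$. Let $\mathsf W$ be the set of all nonincreasing, left-continuous functions $\varphi:(0,\infty)\to[0,1]$, ordered by $\varphi\preceq\psi$ iff $\varphi(t)\ge\psi(t)$ for all $t$, with the tensor product $(\varphi\star\psi)(u)=\inf_{t+s=u}\varphi(t)\oplus\psi(s)$ and unit the constant function $\mathbf 0$; this is a commutative unital quantale. A $\mathsf W$-category $C$ is a set with hom-objects $C(x,y)\in\mathsf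 W$ such that $\mathbf 0\preceq C(x,x)$ and $C(x,y)\star C(y,z)\preceq C(x,z)$. Its forward (backward) quasi-uniformity is generated by the sets $\{(x,y): C(x,y)(t)<r\}$ (respectively $\{(x,y): C(y,x)(t)<r\}$), $r\in(0,1)$, $t>0$. Let $X_{w^{\mathrm{sym}}}$ be the symmetric $\mathsf W$-category with objects $X$ and hom-objects $t\mapsto w^{\mathrm{sym}}(x,y,t)$. The Cauchy completion $\overline C$ of a $\mathsf W$-category $C$ is the full subcategory of the $\mathsf W$-category of presheaves on $C$ (with homs $\bigwedge_x[\varphi(x),\varphi'(x)]$, where $[-,-]$ is the internal hom of $\mathsf W$) whose objects are the Cauchy modules, i.e. the presheaves $\varphi$ for which there is a copresheaf $\psi$ with $\mathbf 0\preceq\bigvee_x\psi(x)\star\varphi(x)$ and $\varphi(x)\star\psi(y)\preceq C(x,y)$ for all $x,y$. Let $j:X\to\overline{X_{w^{\mathrm{sym}}}}$, $j(x)=w^{\mathrm{sym}}(-,x,\cdot)$, be the Yoneda embedding, and let $e:X\to\widehat X$ be the (Hausdorff) uniform completion of $(X,\mathcal U(w^{\mathrm{sym}}))$. Theorem. There is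 exactly one bijection $\Phi:\overline{X_{w^{\mathrm{sym}}}}\to\widehat X$ with $\Phi\circ j=e$ that is a bi-uniform isomorphism, i.e. such that $\Phi$ and $\Phi^{-1}$ are uniformly continuous both for the forward and for the backward quasi-uniformity of $\overline{X_{w^{\mathrm{sym}}}}$ (the uniform space $\widehat X$ carrying its uniformity in both roles). -/

import Mathlib

open scoped unitInterval Uniformity
open Quantale

namespace QuasiModular

/-- The scale parameters: the open half-line `(0, ∞)`. -/
abbrev Scale : Type := {t : ℝ // 0 < t}

/-- A continuous t-conorm on the unit interval `[0, 1]`. -/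
structure TConorm where
  op : I → I → I
  continuous_op : Continuous (fun p : I × I => op p.1 p.2)
  comm : ∀ a b, op a b = op b a
  assoc : ∀ a b c, op (op a b) c = op a (op b c)
  mono : ∀ a b c, a ≤ b → op a c ≤ op b c
  op_zero : ∀ a, op a 0 = a

namespace TConorm

variable (S : TConorm)

theorem mono₂ {a b c d : I} (h : a ≤ c) (k : b ≤ d) : S.op a b ≤ S.op c d := by
  refine (S.mono _ _ _ h).trans ?_
  rw [S.comm c b, S.comm c d]
  exact S.mono _ _ _ k

theorem zero_op (a : I) : S.op 0 a = a := by rw [S.comm, S.op_zero]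

theorem le_left (a b : I) : a ≤ S.op a b := by
  have h := S.mono₂ (le_refl a) (bot_le : (⊥ : I) ≤ b)
  exact (S.op_zero a).symm.le.trans h

theorem le_right (a b : I) : b ≤ S.op a b := by
  rw [S.comm]; exact S.le_left b a

theorem op_iInf {ι : Sort*} (f : ι → I) (b : I) : S.op (⨅ i, f i) b = ⨅ i, S.op (f i) b := by
  have hc : Continuous (fun a => S.op a b) :=
    S.continuous_op.comp (Continuous.prodMk continuous_id continuous_const)
  refine Monotone.map_iInf_of_continuousAt (f := fun a => S.op a b) hc.continuousAt
    (fun _ _ h => S.mono _ _ _ h) ?_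
  exact top_le_iff.mp (S.le_left ⊤ b)

/-- Continuity at the origin: small elements have small `⊕`-squares. -/
theorem exists_op_self_lt {r : I} (hr : 0 < r) : ∃ r' : I, 0 < r' ∧ r' ≤ r ∧ S.op r' r' < r := by
  have hc : Continuous (fun a : I => S.op a a) :=
    S.continuous_op.comp (Continuous.prodMk continuous_id continuous_id)
  have h0 : S.op 0 0 < r := by rw [S.op_zero]; exact hr
  have hU : {a : I | S.op a a < r} ∈ nhds (0 : I) :=
    (isOpen_lt hc continuous_const).mem_nhds h0
  obtain ⟨ε, hε, hb⟩ := Metric.mem_nhds_iff.mp hU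
  have hr' : (0 : ℝ) < (r : ℝ) := hr
  have hm : 0 < min (ε / 2) (r : ℝ) := lt_min (by linarith) hr'
  refine ⟨⟨min (ε / 2) (r : ℝ), hm.le, (min_le_right _ _).trans r.2.2⟩, hm,
    min_le_right (ε / 2) (r : ℝ), ?_⟩
  apply hb
  rw [Metric.mem_ball, Subtype.dist_eq, Real.dist_eq]
  simp only [Set.Icc.coe_zero, sub_zero, abs_of_pos hm]
  exact lt_of_le_of_lt (min_le_left _ _) (by linarith)

end TConorm

theorem leftCts_iff {f : Scale → I} (hf : Antitone f) (u : Scale) :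
    ContinuousWithinAt f (Set.Iio u) u ↔ ∀ c, f u < c → ∃ t, t < u ∧ f t < c := by
  constructor
  · intro h c hc
    have h1 : ∀ᶠ t in nhdsWithin u (Set.Iio u), f t < c := h.eventually_lt_const hc
    obtain ⟨ε, hε, hb⟩ := Metric.mem_nhdsWithin_iff.mp h1
    have hu : 0 < (u : ℝ) := u.2
    have hm : 0 < min ε (u : ℝ) := lt_min hε hu
    have hm1 := min_le_left ε (u : ℝ)
    have hm2 := min_le_right ε (u : ℝ)
    have hlt : (⟨(u : ℝ) - min ε u / 2, by linarith⟩ : Scale) < u := by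
      change (u : ℝ) - min ε u / 2 < u
      linarith
    refine ⟨_, hlt, hb ⟨?_, hlt⟩⟩
    rw [Metric.mem_ball, Subtype.dist_eq, Real.dist_eq, abs_lt]
    constructor <;> simp only <;> linarith
  · intro h
    refine tendsto_order.mpr ⟨fun a ha => ?_, fun c hc => ?_⟩
    · filter_upwards [self_mem_nhdsWithin] with t ht
      exact lt_of_lt_of_le ha (hf (le_of_lt ht))
    · obtain ⟨t, htu, htc⟩ := h c hc
      have : {s : Scale | t < s} ∈ nhds u := (isOpen_lt continuous_const continuous_id).mem_nhds htu
      filter_upwards [mem_nhdsWithin_of_mem_nhds this] with s hs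
      exact lt_of_le_of_lt (hf (le_of_lt hs)) htc

/-! ### The convolution quantale -/

/-- The elements of the convolution quantale: nonincreasing, left-continuous functions
`(0, ∞) → [0, 1]`. -/
@[ext]
structure Profile (S : TConorm) where
  toFun : Scale → I
  antitone : Antitone toFun
  leftCts : ∀ u, ContinuousWithinAt toFun (Set.Iio u) u

namespace Profile

variable {S : TConorm}

theorem exists_lt (φ : Profile S) {u : Scale} {c : I} (h : φ.toFun u < c) :
    ∃ t, t < u ∧ φ.toFun t < c :=
  (leftCts_iff φ.antitone u).mp (φ.leftCts u) c h

/-- The order is the reverse of the pointwise order. -/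
instance : PartialOrder (Profile S) where
  le φ ψ := ∀ t, ψ.toFun t ≤ φ.toFun t
  le_refl φ t := le_rfl
  le_trans φ ψ χ h k t := (k t).trans (h t)
  le_antisymm φ ψ h k := Profile.ext (funext fun t => le_antisymm (k t) (h t))

theorem le_def {φ ψ : Profile S} : φ ≤ ψ ↔ ∀ t, ψ.toFun t ≤ φ.toFun t := Iff.rfl

/-- Suprema are pointwise infima. -/
noncomputable instance : SupSet (Profile S) where
  sSup A :=
    { toFun := fun t => ⨅ φ : A, φ.1.toFun t
      antitone := fun _ _ h => iInf_mono fun φ => φ.1.antitone h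
      leftCts := fun u => by
        refine (leftCts_iff (fun _ _ h => iInf_mono fun φ => φ.1.antitone h) u).mpr ?_
        intro c hc
        obtain ⟨φ, hφ⟩ := iInf_lt_iff.mp hc
        obtain ⟨t, htu, ht⟩ := φ.1.exists_lt hφ
        exact ⟨t, htu, lt_of_le_of_lt (iInf_le _ φ) ht⟩ }

theorem sSup_toFun (A : Set (Profile S)) (t : Scale) :
    (sSup A).toFun t = ⨅ φ : A, φ.1.toFun t := rfl

noncomputable instance : CompleteLattice (Profile S) :=
  completeLatticeOfSup (Profile S) fun A =>
    ⟨fun φ hφ t => iInf_le (fun ψ : A => ψ.1.toFun t) ⟨φ, hφ⟩,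
      fun _ hψ t => le_iInf fun φ => hψ φ.2 t⟩

/-- Convolution: `(φ ⋆ ψ)(u) = inf_{t + s = u} φ(t) ⊕ ψ(s)`. -/
noncomputable def convFun (φ ψ : Profile S) (u : Scale) : I :=
  ⨅ p : {p : Scale × Scale // p.1 + p.2 = u}, S.op (φ.toFun p.1.1) (ψ.toFun p.1.2)

theorem convFun_lt_iff {φ ψ : Profile S} {u : Scale} {c : I} :
    convFun φ ψ u < c ↔ ∃ t s : Scale, t + s = u ∧ S.op (φ.toFun t) (ψ.toFun s) < c := by
  unfold convFun
  rw [iInf_lt_iff]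
  constructor
  · rintro ⟨⟨⟨t, s⟩, h⟩, hlt⟩
    exact ⟨t, s, h, hlt⟩
  · rintro ⟨t, s, h, hlt⟩
    exact ⟨⟨⟨t, s⟩, h⟩, hlt⟩

theorem convFun_le (φ ψ : Profile S) (t s : Scale) :
    convFun φ ψ (t + s) ≤ S.op (φ.toFun t) (ψ.toFun s) :=
  iInf_le (fun p : {p : Scale × Scale // p.1 + p.2 = t + s} =>
    S.op (φ.toFun p.1.1) (ψ.toFun p.1.2)) ⟨(t, s), rfl⟩

theorem convFun_antitone (φ ψ : Profile S) : Antitone (convFun φ ψ) := by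
  intro u v huv
  refine le_iInf ?_
  rintro ⟨⟨t, s⟩, rfl⟩
  have h : ((t + s : Scale) : ℝ) ≤ v := huv
  have h' : (t : ℝ) + s ≤ v := h
  have hs : 0 < (s : ℝ) := s.2
  have hv : t + (⟨(v : ℝ) - t, by linarith⟩ : Scale) = v := by
    refine Subtype.ext ?_
    change (t : ℝ) + (v - t) = v
    ring
  have hle : s ≤ (⟨(v : ℝ) - t, by linarith⟩ : Scale) := by
    change (s : ℝ) ≤ v - t
    linarith
  have := convFun_le φ ψ t ⟨(v : ℝ) - t, by linarith⟩
  rw [hv] at this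
  exact this.trans (S.mono₂ le_rfl (ψ.antitone hle))

theorem convFun_exists_lt (φ ψ : Profile S) (u : Scale) (c : I) (h : convFun φ ψ u < c) :
    ∃ v, v < u ∧ convFun φ ψ v < c := by
  obtain ⟨t, s, hu, hlt⟩ := convFun_lt_iff.mp h
  have hc : Continuous (fun a => S.op a (ψ.toFun s)) :=
    S.continuous_op.comp (Continuous.prodMk continuous_id continuous_const)
  have h1 : ContinuousWithinAt (fun v => S.op (φ.toFun v) (ψ.toFun s)) (Set.Iio t) t :=
    hc.continuousAt.comp_continuousWithinAt (φ.leftCts t)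
  obtain ⟨t', ht', hlt'⟩ :=
    (leftCts_iff (fun _ _ k => S.mono _ _ _ (φ.antitone k)) t).mp h1 c hlt
  refine ⟨t' + s, ?_, lt_of_le_of_lt (convFun_le φ ψ t' s) hlt'⟩
  rw [← hu]
  change (t' : ℝ) + s < t + s
  have : (t' : ℝ) < t := ht'
  linarith

noncomputable instance : Mul (Profile S) where
  mul φ ψ :=
    { toFun := convFun φ ψ
      antitone := convFun_antitone φ ψ
      leftCts := fun u =>
        (leftCts_iff (convFun_antitone φ ψ) u).mpr (convFun_exists_lt φ ψ u) }

theorem mul_toFun (φ ψ : Profile S) (u : Scale) :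
    (φ * ψ).toFun u =
      ⨅ p : {p : Scale × Scale // p.1 + p.2 = u}, S.op (φ.toFun p.1.1) (ψ.toFun p.1.2) := rfl

/-- The unit is the constant function `0`. -/
instance : One (Profile S) where
  one :=
    { toFun := fun _ => 0
      antitone := fun _ _ _ => le_rfl
      leftCts := fun _ => continuousWithinAt_const }

theorem one_toFun (u : Scale) : (1 : Profile S).toFun u = 0 := rfl

theorem le_mul_iff {φ ψ χ : Profile S} :
    χ ≤ φ * ψ ↔ ∀ u, convFun φ ψ u ≤ χ.toFun u := Iff.rfl

theorem mul_le_iff {φ ψ χ : Profile S} :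
    φ * ψ ≤ χ ↔ ∀ t s, χ.toFun (t + s) ≤ S.op (φ.toFun t) (ψ.toFun s) := by
  constructor
  · intro h t s
    exact (h (t + s)).trans (convFun_le φ ψ t s)
  · intro h u
    refine le_iInf ?_
    rintro ⟨⟨t, s⟩, rfl⟩
    exact h t s

theorem conv_comm (φ ψ : Profile S) : φ * ψ = ψ * φ := by
  have key : ∀ α β : Profile S, α * β ≤ β * α := fun α β u =>
    le_iInf fun p => by
      obtain ⟨⟨t, s⟩, rfl⟩ := p
      have := convFun_le β α s t
      rw [add_comm, S.comm] at this
      exact this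
  exact le_antisymm (key φ ψ) (key ψ φ)

theorem conv_assoc_le (φ ψ χ : Profile S) : φ * (ψ * χ) ≤ φ * ψ * χ := by
  intro u
  refine le_iInf ?_
  rintro ⟨⟨t, s⟩, rfl⟩
  change convFun (φ * ψ) χ (t + s) ≤ S.op (φ.toFun t) ((ψ * χ).toFun s)
  rw [S.comm, mul_toFun, S.op_iInf]
  refine le_iInf ?_
  rintro ⟨⟨a, b⟩, rfl⟩
  change convFun (φ * ψ) χ (t + (a + b)) ≤ S.op (S.op (ψ.toFun a) (χ.toFun b)) (φ.toFun t)
  rw [S.comm, ← S.assoc, ← add_assoc]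
  exact (convFun_le (φ * ψ) χ (t + a) b).trans (S.mono _ _ _ (convFun_le φ ψ t a))

theorem conv_assoc (φ ψ χ : Profile S) : φ * ψ * χ = φ * (ψ * χ) := by
  refine le_antisymm ?_ (conv_assoc_le φ ψ χ)
  rw [conv_comm (φ * ψ) χ, conv_comm φ ψ, conv_comm φ (ψ * χ), conv_comm ψ χ]
  exact conv_assoc_le χ ψ φ

theorem conv_one (φ : Profile S) : φ * 1 = φ := by
  refine le_antisymm (mul_le_iff.mpr fun t s => ?_) (fun u => ?_)
  · rw [one_toFun, S.op_zero]
    refine φ.antitone ?_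
    change (t : ℝ) ≤ t + s
    have : 0 < (s : ℝ) := s.2
    linarith
  · refine le_of_forall_gt fun c hc => ?_
    obtain ⟨t, htu, ht⟩ := φ.exists_lt hc
    have htu' : (t : ℝ) < u := htu
    refine convFun_lt_iff.mpr ⟨t, ⟨(u : ℝ) - t, by linarith⟩, Subtype.ext ?_, ?_⟩
    · change (t : ℝ) + (u - t) = u
      ring
    · rw [one_toFun, S.op_zero]
      exact ht

noncomputable instance : CommMonoid (Profile S) where
  mul_assoc := conv_assoc
  mul_comm := conv_comm
  mul_one := conv_one
  one_mul φ := by rw [conv_comm]; exact conv_one φ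

theorem conv_sSup (φ : Profile S) (A : Set (Profile S)) : φ * sSup A = ⨆ ψ ∈ A, φ * ψ := by
  refine le_antisymm (mul_le_iff.mpr fun t s => ?_)
    (iSup₂_le fun ψ hψ => ?_)
  · rw [S.comm, sSup_toFun, S.op_iInf]
    refine le_iInf fun ψ => ?_
    rw [S.comm]
    have h : φ * ψ.1 ≤ ⨆ ψ ∈ A, φ * ψ := le_iSup₂ (f := fun ψ (_ : ψ ∈ A) => φ * ψ) ψ.1 ψ.2
    exact mul_le_iff.mp h t s
  · refine mul_le_iff.mpr fun t s => ?_
    have h : ψ ≤ sSup A := le_sSup hψ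
    refine (convFun_le φ (sSup A) t s).trans (S.mono₂ le_rfl (h s))

instance : IsQuantale (Profile S) where
  mul_sSup_distrib := conv_sSup
  sSup_mul_distrib A φ := by
    rw [mul_comm, conv_sSup]
    simp only [mul_comm]

end Profile

/-! ### Categories enriched over a commutative unital quantale -/

/-- A small category enriched over the commutative unital quantale `V`, with objects `X`. -/
structure VCat (V : Type*) [CommMonoid V] [CompleteLattice V] [IsQuantale V] (X : Type*) where
  hom : X → X → V
  one_le : ∀ x, 1 ≤ hom x x
  comp_le : ∀ x y z, hom x y * hom y z ≤ hom x z

namespace VCat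

variable {V : Type*} [CommMonoid V] [CompleteLattice V] [IsQuantale V] {X : Type*}

/-- Presheaves, i.e. modules from the unit category to `C`. -/
def IsPresheaf (C : VCat V X) (φ : X → V) : Prop :=
  ∀ x y, C.hom x y * φ y ≤ φ x

/-- Copresheaves, i.e. modules from `C` to the unit category. -/
def IsCopresheaf (C : VCat V X) (ψ : X → V) : Prop :=
  ∀ x y, ψ x * C.hom x y ≤ ψ y

/-- The presheaf `φ` is left adjoint, as a module, to the copresheaf `ψ`. -/
structure IsAdjoint (C : VCat V X) (φ ψ : X → V) : Prop where
  unit : 1 ≤ ⨆ x, ψ x * φ x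
  counit : ∀ x y, φ x * ψ y ≤ C.hom x y

/-- Cauchy modules: presheaves that have a right adjoint copresheaf. -/
def IsCauchy (C : VCat V X) (φ : X → V) : Prop :=
  C.IsPresheaf φ ∧ ∃ ψ, C.IsCopresheaf ψ ∧ C.IsAdjoint φ ψ

/-- The objects of the Cauchy completion: the Cauchy modules. -/
def CauchyCompletion (C : VCat V X) : Type _ :=
  {φ : X → V // C.IsCauchy φ}

/-- The Cauchy completion, as a full subcategory of the category of presheaves; the hom-object
from `φ` to `φ'` is the meet over all `x` of the internal homs from `φ x` to `φ' x`. -/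
def cauchyCompletion (C : VCat V X) : VCat V C.CauchyCompletion where
  hom φ φ' := ⨅ x, φ.1 x ⇨ₗ φ'.1 x
  one_le φ := le_iInf fun x => leftMulResiduation_le_iff_mul_le.mpr (one_mul (φ.1 x)).le
  comp_le φ φ' φ'' := le_iInf fun x => leftMulResiduation_le_iff_mul_le.mpr (by
    have h1 := leftMulResiduation_le_iff_mul_le.mp (iInf_le (fun x => φ.1 x ⇨ₗ φ'.1 x) x)
    have h2 := leftMulResiduation_le_iff_mul_le.mp (iInf_le (fun x => φ'.1 x ⇨ₗ φ''.1 x) x)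
    calc (⨅ x, φ.1 x ⇨ₗ φ'.1 x) * (⨅ x, φ'.1 x ⇨ₗ φ''.1 x) * φ.1 x
        = (⨅ x, φ'.1 x ⇨ₗ φ''.1 x) * ((⨅ x, φ.1 x ⇨ₗ φ'.1 x) * φ.1 x) := by
          rw [mul_comm (⨅ x, φ.1 x ⇨ₗ φ'.1 x), mul_assoc]
      _ ≤ (⨅ x, φ'.1 x ⇨ₗ φ''.1 x) * φ'.1 x := mul_le_mul_right h1 _
      _ ≤ φ''.1 x := h2)

/-- The Yoneda embedding `x ↦ C(-, x)` into the Cauchy completion. -/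
def yoneda (C : VCat V X) (a : X) : C.CauchyCompletion :=
  ⟨fun x => C.hom x a, fun x y => C.comp_le x y a, fun y => C.hom a y,
    fun x y => C.comp_le a x y,
    { unit := by
        refine le_trans ?_ (le_iSup (fun x => C.hom a x * C.hom x a) a)
        calc (1 : V) = 1 * 1 := (one_mul 1).symm
          _ ≤ C.hom a a * C.hom a a := mul_le_mul' (C.one_le a) (C.one_le a)
      counit := fun x y => C.comp_le x a y }⟩

end VCat

/-! ### Entourages -/

/-- The filter on `α × α` generated by the sets `{(x, y) | d x y t < r}`, where `0 < r < 1` and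
`t > 0`. -/
def entourages {α : Type*} (d : α → α → Scale → I) : Filter (α × α) :=
  ⨅ q : Set.Ioo (0 : I) 1 × Scale, Filter.principal {p | d p.1 p.2 q.2 < q.1}

/-- The generating sets form a base as soon as `d` is nonincreasing in the scale. -/
theorem mem_entourages_iff {α : Type*} {d : α → α → Scale → I} (hd : ∀ x y, Antitone (d x y))
    (V : Set (α × α)) :
    V ∈ entourages d ↔
      ∃ (r : I) (t : Scale), 0 < r ∧ r < 1 ∧ {p : α × α | d p.1 p.2 t < r} ⊆ V := by
  have hne : Nonempty (Set.Ioo (0 : I) 1 × Scale) :=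
    ⟨⟨⟨1 / 2, by norm_num, by norm_num⟩, by
      constructor
      · change (0 : ℝ) < 1 / 2
        norm_num
      · change (1 / 2 : ℝ) < 1
        norm_num⟩, ⟨1, one_pos⟩⟩
  have hdir : Directed (· ≥ ·) (fun q : Set.Ioo (0 : I) 1 × Scale =>
      Filter.principal {p : α × α | d p.1 p.2 q.2 < q.1}) := by
    intro q q'
    refine ⟨(⟨min q.1.1 q'.1.1, lt_min q.1.2.1 q'.1.2.1, (min_le_left _ _).trans_lt q.1.2.2⟩,
      min q.2 q'.2), ?_, ?_⟩
    · refine Filter.principal_mono.mpr fun p hp => ?_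
      exact (hd _ _ (min_le_left _ _)).trans_lt (lt_of_lt_of_le hp (min_le_left _ _))
    · refine Filter.principal_mono.mpr fun p hp => ?_
      exact (hd _ _ (min_le_right _ _)).trans_lt (lt_of_lt_of_le hp (min_le_right _ _))
  unfold entourages
  rw [Filter.mem_iInf_of_directed hdir]
  constructor
  · rintro ⟨⟨r, t⟩, h⟩
    exact ⟨r.1, t, r.2.1, r.2.2, Filter.mem_principal.mp h⟩
  · rintro ⟨r, t, hr, hr1, h⟩
    exact ⟨(⟨r, hr, hr1⟩, t), Filter.mem_principal.mpr h⟩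

/-- The forward quasi-uniformity of a category enriched over the convolution quantale. -/
def forward {S : TConorm} {α : Type*} (C : VCat (Profile S) α) : Filter (α × α) :=
  entourages fun x y t => (C.hom x y).toFun t

/-- The backward quasi-uniformity of a category enriched over the convolution quantale. -/
def backward {S : TConorm} {α : Type*} (C : VCat (Profile S) α) : Filter (α × α) :=
  entourages fun x y t => (C.hom y x).toFun t

/-- A bijection from a category enriched over the convolution quantale onto a uniform space is a
bi-uniform isomorphism if it and its inverse are uniformly continuous both for the forward and
for the backward quasi-uniformity. (The uniformity of a uniform space is its own inverse, so that
it serves as its forward and as its backward quasi-uniformity.) -/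
structure IsBiUniformIso {S : TConorm} {α β : Type*} (C : VCat (Profile S) α) [UniformSpace β]
    (Φ : α ≃ β) : Prop where
  forward : Filter.Tendsto (Prod.map Φ Φ) (forward C) (𝓤 β)
  backward : Filter.Tendsto (Prod.map Φ Φ) (backward C) (𝓤 β)
  forward_symm : Filter.Tendsto (Prod.map Φ.symm Φ.symm) (𝓤 β) (QuasiModular.forward C)
  backward_symm : Filter.Tendsto (Prod.map Φ.symm Φ.symm) (𝓤 β) (QuasiModular.backward C)

/-! ### Quasi-modular gauges -/

/-- A quasi-modular gauge on `X` with respect to the continuous t-conorm `S`; the values lie in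
`[0, 1)` by `lt_one`. No symmetry is required. -/
structure Gauge (S : TConorm) (X : Type*) where
  w : X → X → Scale → I
  lt_one : ∀ x y t, w x y t < 1
  eq_zero_iff : ∀ x y t, w x y t = 0 ↔ x = y
  triangle : ∀ x y z t s, w x z (t + s) ≤ S.op (w x y t) (w y z s)
  continuous : ∀ x y, Continuous (w x y)
  antitone : ∀ x y, Antitone (w x y)

namespace Gauge

variable {S : TConorm} {X : Type*}

/-- The symmetrization `w^sym(x, y, t) = w(x, y, t) ⊕ w(y, x, t)`. -/
def sym (w : Gauge S X) (x y : X) (t : Scale) : I :=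
  S.op (w.w x y t) (w.w y x t)

theorem sym_self (w : Gauge S X) (x : X) (t : Scale) : w.sym x x t = 0 := by
  rw [sym, (w.eq_zero_iff x x t).mpr rfl, S.op_zero]

theorem sym_comm (w : Gauge S X) (x y : X) (t : Scale) : w.sym x y t = w.sym y x t :=
  S.comm _ _

theorem sym_antitone (w : Gauge S X) (x y : X) : Antitone (w.sym x y) := fun _ _ h =>
  S.mono₂ (w.antitone x y h) (w.antitone y x h)

theorem sym_continuous (w : Gauge S X) (x y : X) : Continuous (w.sym x y) :=
  S.continuous_op.comp (Continuous.prodMk (w.continuous x y) (w.continuous y x))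

theorem sym_triangle (w : Gauge S X) (x y z : X) (t s : Scale) :
    w.sym x z (t + s) ≤ S.op (w.sym x y t) (w.sym y z s) := by
  have h2 := w.triangle z y x s t
  rw [add_comm s t] at h2
  refine (S.mono₂ (w.triangle x y z t s) h2).trans (le_of_eq ?_)
  change S.op (S.op (w.w x y t) (w.w y z s)) (S.op (w.w z y s) (w.w y x t)) =
    S.op (S.op (w.w x y t) (w.w y x t)) (S.op (w.w y z s) (w.w z y s))
  rw [S.assoc, S.assoc, ← S.assoc (w.w y z s), S.comm (S.op (w.w y z s) (w.w z y s))]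

/-- The symmetric enriched category `X_{w^sym}`, whose hom-objects are the profiles
`t ↦ w^sym(x, y, t)`. -/
def symCat (w : Gauge S X) : VCat (Profile S) X where
  hom x y :=
    { toFun := w.sym x y
      antitone := w.sym_antitone x y
      leftCts := fun _ => (w.sym_continuous x y).continuousWithinAt }
  one_le x t := (w.sym_self x t).le
  comp_le x y z := Profile.mul_le_iff.mpr fun t s => w.sym_triangle x y z t s

/-- The uniformity `U(w^sym)` generated by the entourages `{(x, y) | w^sym(x, y, t) < r}`. -/
abbrev symUniformSpace (w : Gauge S X) : UniformSpace X :=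
  UniformSpace.ofCore
    { uniformity := entourages w.sym
      refl := by
        intro V hV
        obtain ⟨r, t, hr, -, hV⟩ := (mem_entourages_iff w.sym_antitone V).mp hV
        rintro ⟨x, y⟩ (rfl : x = y)
        refine hV ?_
        change w.sym x x t < r
        rw [w.sym_self]
        exact hr
      symm := by
        intro V hV
        obtain ⟨r, t, hr, hr1, hV⟩ := (mem_entourages_iff w.sym_antitone V).mp hV
        refine (mem_entourages_iff w.sym_antitone _).mpr ⟨r, t, hr, hr1, ?_⟩
        rintro ⟨x, y⟩ h
        refine hV ?_
        change w.sym y x t < r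
        rw [w.sym_comm]
        exact h
      comp := by
        intro V hV
        obtain ⟨r, t, hr, hr1, hV⟩ := (mem_entourages_iff w.sym_antitone V).mp hV
        obtain ⟨r', hr', hle, hlt⟩ := S.exists_op_self_lt hr
        have ht : 0 < (t : ℝ) := t.2
        obtain ⟨t', htt⟩ : ∃ t' : Scale, t' + t' = t :=
          ⟨⟨(t : ℝ) / 2, by linarith⟩, Subtype.ext (add_halves (t : ℝ))⟩
        have hE : {p : X × X | w.sym p.1 p.2 t' < r'} ∈ entourages w.sym :=
          (mem_entourages_iff w.sym_antitone _).mpr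
            ⟨r', t', hr', lt_of_le_of_lt hle hr1, subset_rfl⟩
        refine Filter.mem_of_superset (Filter.mem_lift' hE) ?_
        rintro ⟨x, z⟩ ⟨y, hxy, hyz⟩
        refine hV ?_
        change w.sym x z t < r
        rw [← htt]
        exact lt_of_le_of_lt ((w.sym_triangle x y z t' t').trans
          (S.mono₂ (le_of_lt hxy) (le_of_lt hyz))) hlt }

end Gauge

end QuasiModular

namespace QuasiModular

open Filter Topology

namespace TConorm

variable (S : TConorm)

/-! The completion of a symmetric `C` is shown to be a Hausdorff uniform completion of its objects,
and any two such completions are canonically isomorphic. The crux is that a Cauchy module `φ` is its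
own right adjoint (`isAdjoint_self`). If `ψ` is right adjoint to `φ`, the unit gives, at every
scale, points where both are arbitrarily small, so by continuity of ⊕ at 0 the family `ψ x * ψ x`
also has join above the unit. Counit and copresheaf law then give `φ ≤ ψ`, and exchanging roles
gives equality. Hence `hom φ φ'` is the join of `φ x * φ' x`, which is symmetric: forward and
backward quasi-uniformities coincide and form a uniformity. By the Yoneda lemma `φ x` is the
distance from `x` to `φ`, so the Yoneda embedding induces the uniformity of `C` and has dense range.
Homs above the unit both ways force equality, which gives separation. A Cauchy filter converges to
the upper limit of its representables (`isCauchy_limsupHom`), which gives completeness. Density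
determines the isomorphism. -/

theorem exists_op_lt {r : I} (hr : 0 < r) : ∃ r' : I, 0 < r' ∧ ∀ a b, a < r' → b < r' →
    S.op a b < r := by
  obtain ⟨r', hr', -, hlt⟩ := S.exists_op_self_lt hr
  exact ⟨r', hr', fun a b ha hb => (S.mono₂ ha.le hb.le).trans_lt hlt⟩

end TConorm

theorem Scale.exists_add_self (t : Scale) : ∃ s : Scale, s + s = t :=
  ⟨⟨(t : ℝ) / 2, half_pos t.2⟩, Subtype.ext (add_halves (t : ℝ))⟩

theorem Scale.lt_add_left (t s : Scale) : s < t + s :=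
  show (s : ℝ) < t + s by linarith [t.2]

theorem Scale.lt_add_right (t s : Scale) : t < t + s :=
  show (t : ℝ) < t + s by linarith [s.2]

/-! ### Pointwise estimates in the convolution quantale -/

namespace Profile

variable {S : TConorm}

theorem one_le_iff {φ : Profile S} : 1 ≤ φ ↔ ∀ t, φ.toFun t = 0 :=
  forall_congr' fun _ => le_bot_iff

theorem iSup_toFun {ι : Sort*} (f : ι → Profile S) (t : Scale) :
    (⨆ i, f i).toFun t = ⨅ i, (f i).toFun t := by
  rw [iSup, sSup_toFun]
  exact iInf_range' (fun φ : Profile S => φ.toFun t) f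

/-- Joins are pointwise infima, so the unit of an adjunction turns into the existence of
approximating points at every scale. -/
theorem one_le_iSup_iff {ι : Sort*} {f : ι → Profile S} :
    1 ≤ ⨆ i, f i ↔ ∀ t (r : I), 0 < r → ∃ i, (f i).toFun t < r := by
  rw [one_le_iff]
  refine forall_congr' fun t => ?_
  rw [iSup_toFun]
  exact iInf_eq_bot

/-- The value of a convolution dominates the values of its factors at the same scale. -/
theorem toFun_lt_of_mul_lt {φ ψ : Profile S} {t : Scale} {r : I} (h : (φ * ψ).toFun t < r) :
    φ.toFun t < r ∧ ψ.toFun t < r := by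
  obtain ⟨a, b, rfl, hlt⟩ := convFun_lt_iff.mp h
  exact ⟨((φ.antitone (Scale.lt_add_right a b).le).trans (S.le_left _ _)).trans_lt hlt,
    ((ψ.antitone (Scale.lt_add_left a b).le).trans (S.le_right _ _)).trans_lt hlt⟩

/-- The profile with value `1` on `(0, t]` and `r` beyond `t`. -/
noncomputable def step (S : TConorm) (t : Scale) (r : I) : Profile S where
  toFun s := if s ≤ t then 1 else r
  antitone a b hab := by
    dsimp only
    split_ifs with h1 h2
    · exact le_rfl
    · exact absurd (hab.trans h1) h2
    · exact le_top
    · exact le_rfl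
  leftCts u := by
    refine (leftCts_iff ?_ u).mpr fun c hc => ?_
    · intro a b hab
      dsimp only
      split_ifs with h1 h2
      · exact le_rfl
      · exact absurd (hab.trans h1) h2
      · exact le_top
      · exact le_rfl
    · by_cases h : u ≤ t
      · rw [if_pos h] at hc
        exact absurd hc (not_lt_of_ge le_top)
      · rw [if_neg h] at hc
        obtain ⟨v, hv, hvu⟩ : ∃ v : ℝ, (t : ℝ) < v ∧ v < u := exists_between (not_le.mp h)
        refine ⟨⟨v, t.2.trans hv⟩, hvu, ?_⟩
        rwa [if_neg (show ¬(⟨v, t.2.trans hv⟩ : Scale) ≤ t from not_le.mpr hv)]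

theorem step_toFun_of_lt {t s : Scale} (h : t < s) (r : I) : (step S t r).toFun s = r :=
  if_neg (not_le.mpr h)

/-- A pointwise supremum of left-continuous profiles may fail to be left-continuous, so meets are
not computed pointwise. Steps serve instead as explicit lower bounds: one value of `φ` controls it
beyond `t`. -/
theorem step_le {φ : Profile S} {t : Scale} {r : I} (h : φ.toFun t ≤ r) : step S t r ≤ φ := by
  intro s
  by_cases hs : s ≤ t
  · exact le_top.trans (if_pos hs).ge
  · exact ((φ.antitone (not_le.mp hs).le).trans h).trans (if_neg hs).ge

end Profile

namespace VCat

/-! ### Symmetric categories and Cauchy modules over a general quantale -/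

section Quantale

variable {V : Type*} [CommMonoid V] [CompleteLattice V] [IsQuantale V] {X : Type*}

/-- Symmetric enriched categories. -/
def IsSymm (C : VCat V X) : Prop :=
  ∀ x y, C.hom x y = C.hom y x

variable {C : VCat V X}

theorem IsAdjoint.symm (hC : C.IsSymm) {φ ψ : X → V} (h : C.IsAdjoint φ ψ) :
    C.IsAdjoint ψ φ where
  unit := by simpa only [mul_comm] using h.unit
  counit x y := by
    rw [mul_comm, hC]
    exact h.counit y x

theorem IsSymm.isPresheaf_iff (hC : C.IsSymm) {φ : X → V} :
    C.IsPresheaf φ ↔ C.IsCopresheaf φ := by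
  constructor
  · intro h x y
    rw [mul_comm, hC]
    exact h y x
  · intro h x y
    rw [mul_comm, hC]
    exact h y x

/-- The Yoneda lemma. -/
theorem hom_yoneda (C : VCat V X) (a : X) (φ : C.CauchyCompletion) :
    C.cauchyCompletion.hom (C.yoneda a) φ = φ.1 a := by
  refine le_antisymm ?_ (le_iInf fun x => ?_)
  · have h : C.cauchyCompletion.hom (C.yoneda a) φ * C.hom a a ≤ φ.1 a :=
      leftMulResiduation_le_iff_mul_le.mp (iInf_le (fun x => C.hom x a ⇨ₗ φ.1 x) a)
    refine le_trans ?_ h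
    exact (mul_one _).symm.le.trans (mul_le_mul_right (C.one_le a) _)
  · refine leftMulResiduation_le_iff_mul_le.mpr ?_
    rw [mul_comm]
    exact φ.2.1 x a

/-- The hom-object out of a module with right adjoint `ψ` is a tensor product with `ψ`. -/
theorem hom_eq_iSup {φ φ' : C.CauchyCompletion} {ψ : X → V} (h : C.IsAdjoint φ.1 ψ) :
    C.cauchyCompletion.hom φ φ' = ⨆ x, ψ x * φ'.1 x := by
  -- One direction inserts the unit and evaluates the hom at each `x`; the other uses the counit and
  -- the presheaf law of `φ'`.
  refine le_antisymm ?_ (iSup_le fun x => le_iInf fun y => ?_)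
  · calc C.cauchyCompletion.hom φ φ' = C.cauchyCompletion.hom φ φ' * 1 := (mul_one _).symm
      _ ≤ C.cauchyCompletion.hom φ φ' * ⨆ x, ψ x * φ.1 x := mul_le_mul_right h.unit _
      _ = ⨆ x, C.cauchyCompletion.hom φ φ' * (ψ x * φ.1 x) := mul_iSup_distrib
      _ ≤ ⨆ x, ψ x * φ'.1 x := iSup_mono fun x => by
        rw [mul_left_comm]
        exact mul_le_mul_right (leftMulResiduation_le_iff_mul_le.mp
          (iInf_le (fun x => φ.1 x ⇨ₗ φ'.1 x) x)) _
  · refine leftMulResiduation_le_iff_mul_le.mpr ?_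
    calc ψ x * φ'.1 x * φ.1 y = φ.1 y * ψ x * φ'.1 x := by
          rw [mul_comm, mul_assoc]
      _ ≤ C.hom y x * φ'.1 x := mul_le_mul_left (h.counit y x) _
      _ ≤ φ'.1 y := φ'.2.1 y x

theorem le_of_one_le_hom {φ φ' : C.CauchyCompletion} (h : 1 ≤ C.cauchyCompletion.hom φ φ')
    (x : X) : φ.1 x ≤ φ'.1 x := by
  have := leftMulResiduation_le_iff_mul_le.mp (h.trans (iInf_le (fun x => φ.1 x ⇨ₗ φ'.1 x) x))
  rwa [one_mul] at this

/-- The upper limit of the representable presheaves along a filter. -/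
def limsupHom (C : VCat V X) (F : Filter X) (y : X) : V :=
  ⨆ A : {A : Set X // A ∈ F}, ⨅ x : A.1, C.hom y x

theorem isPresheaf_limsupHom (C : VCat V X) (F : Filter X) : C.IsPresheaf (C.limsupHom F) := by
  intro z y
  rw [limsupHom, mul_iSup_distrib]
  exact iSup_mono fun A => le_iInf fun x =>
    (mul_le_mul_right (iInf_le _ x) _).trans (C.comp_le z y x)

/-- Two members of a proper filter share a point `a`, and composition through `a` bounds the
product. -/
theorem limsupHom_mul_le (hC : C.IsSymm) (F : Filter X) [F.NeBot] (x y : X) :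
    C.limsupHom F x * C.limsupHom F y ≤ C.hom x y := by
  rw [limsupHom, limsupHom, iSup_mul_distrib]
  refine iSup_le fun A => ?_
  rw [mul_iSup_distrib]
  refine iSup_le fun B => ?_
  obtain ⟨a, haA, haB⟩ := F.nonempty_of_mem (inter_mem A.2 B.2)
  refine (mul_le_mul' (iInf_le _ (⟨a, haA⟩ : A.1)) (iInf_le _ (⟨a, haB⟩ : B.1))).trans ?_
  rw [hC y]
  exact C.comp_le x a y

end Quantale

/-! ### Self-adjointness of Cauchy modules and the induced uniformity -/

variable {S : TConorm} {X : Type*} {C : VCat (Profile S) X}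

theorem IsAdjoint.exists_lt {φ ψ : X → Profile S} (h : C.IsAdjoint φ ψ) (t : Scale) {r : I}
    (hr : 0 < r) : ∃ x, (φ x).toFun t < r ∧ (ψ x).toFun t < r := by
  obtain ⟨x, hx⟩ := Profile.one_le_iSup_iff.mp h.unit t r hr
  exact ⟨x, (Profile.toFun_lt_of_mul_lt hx).symm⟩

/-- The concrete quantale enters here: where `ψ x` is small at half the scale, its ⊕-square is small
at the full scale. -/
theorem IsAdjoint.one_le_iSup_mul_self {φ ψ : X → Profile S} (h : C.IsAdjoint φ ψ) :
    1 ≤ ⨆ x, ψ x * ψ x := by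
  refine Profile.one_le_iSup_iff.mpr fun t r hr => ?_
  obtain ⟨s, rfl⟩ := t.exists_add_self
  obtain ⟨r', hr', hop⟩ := S.exists_op_lt hr
  obtain ⟨x, -, hx⟩ := h.exists_lt s hr'
  exact ⟨x, (Profile.convFun_le _ _ s s).trans_lt (hop _ _ hx hx)⟩

/-- Insert the join of `ψ x * ψ x`; the counit turns `φ y * ψ x` into `C.hom y x`, and the remaining
`ψ x` is carried along it to `ψ y`. -/
theorem IsAdjoint.le (hC : C.IsSymm) {φ ψ : X → Profile S} (h : C.IsAdjoint φ ψ)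
    (hψ : C.IsCopresheaf ψ) (y : X) : φ y ≤ ψ y :=
  calc φ y = φ y * 1 := (mul_one _).symm
    _ ≤ φ y * ⨆ x, ψ x * ψ x := mul_le_mul_right h.one_le_iSup_mul_self _
    _ = ⨆ x, φ y * (ψ x * ψ x) := mul_iSup_distrib
    _ ≤ ψ y := iSup_le fun x => by
      rw [← mul_assoc, mul_comm]
      refine (mul_le_mul_right (h.counit y x) _).trans ?_
      rw [hC]
      exact hψ x y

/-- Over the convolution quantale, the right adjoint of a Cauchy module on a symmetric category
is the module itself. -/
theorem isAdjoint_self (hC : C.IsSymm) (φ : C.CauchyCompletion) : C.IsAdjoint φ.1 φ.1 := by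
  obtain ⟨φ, hφ, ψ, hψ, h⟩ := φ
  -- By symmetry `φ` is also right adjoint to `ψ`, so the comparison applies both ways.
  have : φ = ψ := funext fun y => le_antisymm (h.le hC hψ y)
    ((h.symm hC).le hC (hC.isPresheaf_iff.mp hφ) y)
  subst this
  exact h

theorem IsSymm.cauchyCompletion (hC : C.IsSymm) : C.cauchyCompletion.IsSymm := by
  intro φ φ'
  rw [hom_eq_iSup (isAdjoint_self hC φ), hom_eq_iSup (isAdjoint_self hC φ')]
  simp only [mul_comm]

theorem hom_self_toFun (C : VCat (Profile S) X) (x : X) (t : Scale) :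
    (C.hom x x).toFun t = 0 :=
  Profile.one_le_iff.mp (C.one_le x) t

theorem mem_forward_iff {C : VCat (Profile S) X} {V : Set (X × X)} :
    V ∈ forward C ↔ ∃ (r : I) (t : Scale), 0 < r ∧ r < 1 ∧
      {p : X × X | (C.hom p.1 p.2).toFun t < r} ⊆ V :=
  mem_entourages_iff (fun x y => (C.hom x y).antitone) V

/-- Every basic entourage belongs to the forward quasi-uniformity, whatever the radius. -/
theorem setOf_hom_lt_mem_forward (C : VCat (Profile S) X) (t : Scale) {r : I} (hr : 0 < r) :
    {p : X × X | (C.hom p.1 p.2).toFun t < r} ∈ forward C := by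
  -- Basic entourages need a radius below 1, so the case `r = 1` requires shrinking.
  obtain ⟨q, hq, hqr⟩ := exists_between hr
  exact mem_forward_iff.mpr ⟨q, t, hq, hqr.trans_le le_top, fun _ hp => lt_trans hp hqr⟩

/-- The uniformity of a symmetric category enriched over the convolution quantale. -/
abbrev uniformSpace (C : VCat (Profile S) X) (hC : C.IsSymm) : UniformSpace X :=
  UniformSpace.ofCore
    { uniformity := forward C
      refl := by
        intro V hV
        obtain ⟨r, t, hr, -, hV⟩ := mem_forward_iff.mp hV
        rintro ⟨x, y⟩ (rfl : x = y)
        exact hV ((C.hom_self_toFun x t).trans_lt hr)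
      symm := by
        intro V hV
        obtain ⟨r, t, hr, hr1, hV⟩ := mem_forward_iff.mp hV
        refine mem_forward_iff.mpr ⟨r, t, hr, hr1, ?_⟩
        rintro ⟨x, y⟩ h
        refine hV ?_
        change (C.hom y x).toFun t < r
        rw [hC]
        exact h
      comp := by
        intro V hV
        obtain ⟨r, t, hr, -, hV⟩ := mem_forward_iff.mp hV
        obtain ⟨r', hr', hop⟩ := S.exists_op_lt hr
        obtain ⟨s, rfl⟩ := t.exists_add_self
        refine Filter.mem_of_superset
          (Filter.mem_lift' (C.setOf_hom_lt_mem_forward s hr')) ?_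
        rintro ⟨x, z⟩ ⟨y, hxy, hyz⟩
        exact hV ((Profile.mul_le_iff.mp (C.comp_le x y z) s s).trans_lt (hop _ _ hxy hyz)) }

theorem IsSymm.backward_eq (hC : C.IsSymm) : backward C = forward C :=
  congrArg entourages (funext₂ fun x y => congrArg Profile.toFun (hC y x))

theorem comap_yoneda_forward (C : VCat (Profile S) X) :
    comap (Prod.map C.yoneda C.yoneda) (forward C.cauchyCompletion) = forward C := by
  simp only [forward, entourages, comap_iInf, comap_principal, Set.preimage_ofPred_eq,
    Prod.map_fst, Prod.map_snd, hom_yoneda]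
  rfl

/-! ### The Cauchy completion as a uniform completion -/

section Uniform

variable (hC : C.IsSymm)

theorem mem_nhds_iff {x : X} {U : Set X} :
    U ∈ @nhds X (C.uniformSpace hC).toTopologicalSpace x ↔
      ∃ (r : I) (t : Scale), 0 < r ∧ {y | (C.hom y x).toFun t < r} ⊆ U := by
  let _ := C.uniformSpace hC
  rw [UniformSpace.mem_nhds_iff_symm]
  constructor
  · rintro ⟨V, hV, -, hVU⟩
    obtain ⟨r, t, hr, -, h⟩ := mem_forward_iff.mp hV
    refine ⟨r, t, hr, fun y hy => hVU (h ?_)⟩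
    change (C.hom x y).toFun t < r
    rw [hC]
    exact hy
  · rintro ⟨r, t, hr, h⟩
    rw [← UniformSpace.mem_nhds_iff_symm, UniformSpace.mem_nhds_iff]
    refine ⟨_, C.setOf_hom_lt_mem_forward t hr, fun y hy => h ?_⟩
    change (C.hom y x).toFun t < r
    rw [hC]
    exact hy

theorem isUniformInducing_yoneda :
    @IsUniformInducing _ _ (C.uniformSpace hC)
      (C.cauchyCompletion.uniformSpace hC.cauchyCompletion) C.yoneda := by
  let _ := C.uniformSpace hC
  let _ := C.cauchyCompletion.uniformSpace hC.cauchyCompletion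
  exact ⟨C.comap_yoneda_forward⟩

theorem denseRange_yoneda :
    @DenseRange _ (C.cauchyCompletion.uniformSpace hC.cauchyCompletion).toTopologicalSpace _
      C.yoneda := by
  let _ := C.cauchyCompletion.uniformSpace hC.cauchyCompletion
  intro φ
  refine mem_closure_iff_nhds.mpr fun U hU => ?_
  obtain ⟨r, t, hr, hU⟩ := (mem_nhds_iff hC.cauchyCompletion).mp hU
  obtain ⟨x, hx, -⟩ := (isAdjoint_self hC φ).exists_lt t hr
  refine ⟨C.yoneda x, hU ?_, x, rfl⟩
  change (C.cauchyCompletion.hom (C.yoneda x) φ).toFun t < r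
  rwa [hom_yoneda]

theorem t0Space_cauchyCompletion :
    @T0Space _ (C.cauchyCompletion.uniformSpace hC.cauchyCompletion).toTopologicalSpace := by
  let _ := C.cauchyCompletion.uniformSpace hC.cauchyCompletion
  have key : ∀ φ φ' : C.CauchyCompletion, (∀ V ∈ forward C.cauchyCompletion, (φ, φ') ∈ V) →
      1 ≤ C.cauchyCompletion.hom φ φ' := fun φ φ' h =>
    Profile.one_le_iff.mpr fun t => by
      by_contra hne
      have := h _ (C.cauchyCompletion.setOf_hom_lt_mem_forward t (bot_lt_iff_ne_bot.mpr hne))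
      -- The entourage whose radius is the nonzero value itself excludes the pair.
      exact lt_irrefl ((C.cauchyCompletion.hom φ φ').toFun t) this
  refine t0Space_iff_uniformity.mpr fun φ φ' h => ?_
  have h1 := key φ φ' h
  have h2 := h1
  rw [hC.cauchyCompletion] at h2
  exact Subtype.ext (funext fun x => le_antisymm (le_of_one_le_hom h1 x) (le_of_one_le_hom h2 x))

/-- The upper limit along a Cauchy filter is eventually small along that filter. -/
theorem eventually_limsupHom_lt {F : Filter X} (hF : @Cauchy X (C.uniformSpace hC) F) (t : Scale)
    {r : I} (hr : 0 < r) : ∀ᶠ x in F, (C.limsupHom F x).toFun t < r := by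
  let _ := C.uniformSpace hC
  obtain ⟨q, hq, hqr⟩ := exists_between hr
  obtain ⟨s, rfl⟩ := t.exists_add_self
  obtain ⟨A, hA, hAs⟩ := (cauchy_iff.mp hF).2 _ (C.setOf_hom_lt_mem_forward s hq)
  filter_upwards [hA] with x hx
  -- Every `C.hom x a` with `a ∈ A` is below `q` at scale `s`, so one step bounds the whole meet.
  -- The step takes the value `q` only beyond `s`, whence the evaluation at `s + s`.
  have hle : Profile.step S s q ≤ C.limsupHom F x :=
    le_iSup_of_le ⟨A, hA⟩ (le_iInf fun a => Profile.step_le (le_of_lt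
      (hAs (show (x, (a : X)) ∈ A ×ˢ A from ⟨hx, a.2⟩))))
  refine (hle (s + s)).trans_lt ?_
  rwa [Profile.step_toFun_of_lt (Scale.lt_add_right s s)]

theorem isCauchy_limsupHom {F : Filter X} (hF : @Cauchy X (C.uniformSpace hC) F) :
    C.IsCauchy (C.limsupHom F) := by
  have := hF.1
  have hp := C.isPresheaf_limsupHom F
  refine ⟨hp, C.limsupHom F, hC.isPresheaf_iff.mp hp, ?_, limsupHom_mul_le hC F⟩
  refine Profile.one_le_iSup_iff.mpr fun t r hr => ?_
  obtain ⟨s, rfl⟩ := t.exists_add_self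
  obtain ⟨r', hr', hop⟩ := S.exists_op_lt hr
  obtain ⟨x, hx⟩ := (eventually_limsupHom_lt hC hF s hr').exists
  exact ⟨x, (Profile.convFun_le _ _ s s).trans_lt (hop _ _ hx hx)⟩

/-- By density only Cauchy filters on `X` need limits. The distance from `x` to the candidate is
`limsupHom F x` by Yoneda, which is eventually small. -/
theorem completeSpace_cauchyCompletion :
    @CompleteSpace _ (C.cauchyCompletion.uniformSpace hC.cauchyCompletion) := by
  let _ := C.uniformSpace hC
  let _ := C.cauchyCompletion.uniformSpace hC.cauchyCompletion
  refine completeSpace_extension (isUniformInducing_yoneda hC) (denseRange_yoneda hC)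
    fun F hF => ⟨⟨C.limsupHom F, isCauchy_limsupHom hC hF⟩, fun U hU => ?_⟩
  obtain ⟨r, t, hr, hU⟩ := (mem_nhds_iff hC.cauchyCompletion).mp hU
  refine mem_map.mpr ?_
  filter_upwards [eventually_limsupHom_lt hC hF t hr] with x hx
  exact hU ((congrArg (fun p : Profile S => p.toFun t) (C.hom_yoneda x _)).trans_lt hx)

/-- The Cauchy completion of a symmetric category over the convolution quantale, as a completion
of its uniform space of objects. -/
noncomputable def abstractCompletion : @AbstractCompletion X (C.uniformSpace hC) :=
  letI := C.uniformSpace hC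
  { space := C.CauchyCompletion
    coe := C.yoneda
    uniformStruct := C.cauchyCompletion.uniformSpace hC.cauchyCompletion
    complete := completeSpace_cauchyCompletion hC
    separation := t0Space_cauchyCompletion hC
    isUniformInducing := isUniformInducing_yoneda hC
    dense := denseRange_yoneda hC }

/-- The Cauchy completion of a symmetric category over the convolution quantale is the uniform
completion of its uniform space of objects. -/
theorem existsUnique_isBiUniformIso :
    letI := C.uniformSpace hC
    ∃! Φ : C.CauchyCompletion ≃ UniformSpace.Completion X,
      IsBiUniformIso C.cauchyCompletion Φ ∧
        ∀ x : X, Φ (C.yoneda x) = (x : UniformSpace.Completion X) := by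
  let _ := C.uniformSpace hC
  let _ := C.cauchyCompletion.uniformSpace hC.cauchyCompletion
  let e : C.CauchyCompletion ≃ᵤ UniformSpace.Completion X :=
    (abstractCompletion hC).compareEquiv UniformSpace.Completion.cPkg
  have he : ∀ x : X, e (C.yoneda x) = (x : UniformSpace.Completion X) := fun x =>
    (abstractCompletion hC).compare_coe UniformSpace.Completion.cPkg x
  refine ⟨e.toEquiv, ⟨⟨e.uniformContinuous, ?_, e.symm.uniformContinuous, ?_⟩, he⟩, ?_⟩
  · rw [hC.cauchyCompletion.backward_eq]
    exact e.uniformContinuous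
  · rw [hC.cauchyCompletion.backward_eq]
    exact e.symm.uniformContinuous
  · rintro Φ ⟨hΦ, hΦj⟩
    -- Forward uniform continuity already makes `Φ` continuous; agreement on the dense image then
    -- suffices, the target being Hausdorff.
    have hc : UniformContinuous Φ := hΦ.forward
    refine Equiv.coe_fn_injective ((denseRange_yoneda hC).equalizer hc.continuous
      e.continuous (funext fun x => (hΦj x).trans (he x).symm))

end Uniform

end VCat

theorem Gauge.isSymm_symCat {S : TConorm} {X : Type*} (w : Gauge S X) : w.symCat.IsSymm :=
  fun x y => Profile.ext (funext fun t => w.sym_comm x y t)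

end QuasiModular

theorem mainTheorem1 (S : QuasiModular.TConorm) {X : Type*} (w : QuasiModular.Gauge S X) :
    letI : UniformSpace X := w.symUniformSpace
    ∃! Φ : w.symCat.CauchyCompletion ≃ UniformSpace.Completion X,
      QuasiModular.IsBiUniformIso w.symCat.cauchyCompletion Φ ∧
        ∀ x : X, Φ (w.symCat.yoneda x) = (x : UniformSpace.Completion X) :=
  -- The uniformity of `w.symUniformSpace` is by definition the forward filter of `w.symCat`.
  QuasiModular.VCat.existsUnique_isBiUniformIso w.isSymm_symCat
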